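/- Let $a\ge b\ge 1$ be integers and let $\lambda=(a,b)$ be the two-row Young diagram with $a$ boxes in its upper row and $b$ boxes in its lower row (left-justified). An inverted standard Young tableau of shape $\lambda$ is a filling $\tau$ of the boxes of $\lambda$ with the numbers $1,\dots,a+b$, each used exactly once, whose entries increase from left to right along each row. For an entry $i$ of $\tau$ let $i_k$ denote the entry exactly $k$ boxes to the right of $i$, if it exists. Two entries $i<j$ in the same column of $\tau$ form an inversion pair $(i,j)$ if either (1) at least one of $i_1,j_1$ does not exist and $i$ appears below $j$, or (2) both $i_1$ and $j_1$ exist and $i_1>j_1$. Let $S_k(\lambda)$ be the set of inverted standard Young tableaux of shape $\lambda$ with exactly $k$ inversion pairs. A Dyck path of shape $\lambda$ is a lattice path from $(0,0)$ to $(a,b)$ with steps $(1,0)$ and $(0,1)$ all of whose lattice points $(x,y)$ satisfy $y\le x$. It has a return to ground at each of its lattice points of the form $(x,x)$ with $x$ a positive integer. Let $\mathcal{D}_\lambda(i)$ be the set of Dyck paths of shape $\lambda$ with exactly $i$ returns to ground. Theorem. There are only finitely many inverted standard Young tableaux and finitely many Dyck paths of shape $\lambda$, and, as an identity of polynomials in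 $q$, $$\sum_{k\ge 0} |S_k(\lambda)|\,q^k \;=\; \sum_{i\ge 0} |\mathcal{D}_\lambda(i)|\,(1+q)^i .$$ -/

import Mathlib

open scoped Polynomial

namespace InvertedTableaux

/-- The Young diagram of two-row shape `(a, b)`, where `b ≤ a`. Cells are pairs
`(row, column)`, both counted from `0`, rows from top to bottom, columns from left to right. -/
def twoRow (a b : ℕ) (hab : b ≤ a) : YoungDiagram :=
  YoungDiagram.ofRowLens [a, b] (by simpa [List.sortedGE_iff_pairwise] using hab)

/-- `τ` is a row-standard filling without repeated entries of the diagram `μ` with `N` cells: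
its entries are `1, …, N`, each used exactly once, and they increase from left to right along
every row. The value of `τ` is required to be `0` outside `μ`, so that equal fillings are
equal functions. -/
structure IsInvertedSYT (μ : YoungDiagram) (τ : ℕ → ℕ → ℕ) : Prop where
  row_lt : ∀ r c₁ c₂ : ℕ, c₁ < c₂ → (r, c₂) ∈ μ → τ r c₁ < τ r c₂
  standard : Set.BijOn (fun p : ℕ × ℕ => τ p.1 p.2) {p | p ∈ μ} (Set.Icc 1 μ.card)
  zeros : ∀ r c : ℕ, (r, c) ∉ μ → τ r c = 0

/-- The entry `i` of `τ` in the cell `p` and the entry `j` of `τ` in the cell `q` form an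
inversion pair `(i, j)`: the cells `p`, `q` lie in the same column, `i < j`, and for some `n ≥ 0`
the entries `i_k`, `j_k` that are `k` boxes to the right of `i`, `j` exist and agree for
`1 ≤ k ≤ n`, while
* either one of `i_{n+1}`, `j_{n+1}` does not exist and `i` appears below `j`,
* or both of them exist and `i_{n+1} > j_{n+1}`. -/
def IsInversionPair (μ : YoungDiagram) (τ : ℕ → ℕ → ℕ) (p q : ℕ × ℕ) : Prop :=
  p ∈ μ ∧ q ∈ μ ∧ p.2 = q.2 ∧ τ p.1 p.2 < τ q.1 q.2 ∧
    ∃ n : ℕ,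
      (∀ k : ℕ, 1 ≤ k → k ≤ n →
        (p.1, p.2 + k) ∈ μ ∧ (q.1, q.2 + k) ∈ μ ∧ τ p.1 (p.2 + k) = τ q.1 (q.2 + k)) ∧
      ((((p.1, p.2 + (n + 1)) ∉ μ ∨ (q.1, q.2 + (n + 1)) ∉ μ) ∧ q.1 < p.1) ∨
        ((p.1, p.2 + (n + 1)) ∈ μ ∧ (q.1, q.2 + (n + 1)) ∈ μ ∧
          τ q.1 (q.2 + (n + 1)) < τ p.1 (p.2 + (n + 1))))

open Classical in
/-- The number of inversion pairs of the filling `τ` of `μ`. -/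
noncomputable def inv (μ : YoungDiagram) (τ : ℕ → ℕ → ℕ) : ℕ :=
  ((μ.cells ×ˢ μ.cells).filter fun x => IsInversionPair μ τ x.1 x.2).card

/-- The set of all inverted standard Young tableaux of shape `μ`. -/
def invertedSYT (μ : YoungDiagram) : Set (ℕ → ℕ → ℕ) :=
  {τ | IsInvertedSYT μ τ}

/-- The set `S_k(μ)` of all `k`-inverted standard Young tableaux of shape `μ`. -/
def kInvertedSYT (μ : YoungDiagram) (k : ℕ) : Set (ℕ → ℕ → ℕ) :=
  {τ | τ ∈ invertedSYT μ ∧ inv μ τ = k}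

/-- The set of Dyck paths of shape `(a, b)`, each given by the list `v 0, …, v (a + b)` of its
lattice points: paths from `(0, 0)` to `(a, b)` with steps `(1, 0)` and `(0, 1)`, all of whose
points `(x, y)` satisfy `y ≤ x`. (Such a path never leaves `ℕ × ℕ`.) -/
def dyckPaths (a b : ℕ) : Set (Fin (a + b + 1) → ℕ × ℕ) :=
  {v | v 0 = (0, 0) ∧ v (Fin.last (a + b)) = (a, b) ∧
    (∀ i : Fin (a + b), v i.succ = v i.castSucc + (1, 0) ∨ v i.succ = v i.castSucc + (0, 1)) ∧
    ∀ i : Fin (a + b + 1), (v i).2 ≤ (v i).1}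

open Classical in
/-- The number of returns to ground of a path: the number of its points of the form `(x, x)` with
`x` a positive integer. -/
noncomputable def ret {n : ℕ} (v : Fin n → ℕ × ℕ) : ℕ :=
  (Finset.univ.filter fun i => ∃ x : ℕ, 0 < x ∧ v i = (x, x)).card

/-- The set of Dyck paths of shape `(a, b)` with exactly `i` returns to ground. -/
def dyckPathsWithReturns (a b i : ℕ) : Set (Fin (a + b + 1) → ℕ × ℕ) :=
  {v | v ∈ dyckPaths a b ∧ ret v = i}

end InvertedTableaux

/-! Call a column descending if its lower entry exists and is smaller than its upper one. Distinct
cells hold distinct entries, so whether a column `c < b` contains an inversion pair depends only on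
columns `c` and `c + 1`: it contains one, and only one, exactly when just one of the two columns is
descending. The missing-neighbour clause fits this rule because column `b`, which has no lower
entry, counts as not descending. Hence `inv` equals `signChanges b` (`inv_twoRow`).

Now remove the largest entry of a filling, and the last step of a path. For `b + 1 ≤ a` both
enumerators satisfy the same additive recursion: an entry `N + 1` put at the end of either row
changes no sign count, and a path ending off the diagonal gains no return. On the diagonal a path
has a forced last step and a new return, hence a factor `q` (`pathSum_diagonal`). For fillings,
swapping the rows matches those with the maximum below to those with it above and adds one sign
change, hence a factor `1 + q` (`fillingSum_diagonal`). Replacing `q` by `1 + q` on the path side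
makes the recursions agree (`fillingSum_eq_pathSum`). -/

namespace InvertedTableaux

/-! ### Weighted enumeration -/

/-- Grouping the elements of a finite set by the value of a statistic. -/
theorem finsum_ncard_fiber_smul {α M : Type*} [AddCommMonoid M] {S : Set α} (hS : S.Finite)
    (f : α → ℕ) (g : ℕ → M) :
    ∑ᶠ k : ℕ, {x | x ∈ S ∧ f x = k}.ncard • g k = ∑ᶠ x ∈ S, g (f x) := by
  classical
  obtain ⟨s, rfl⟩ := hS.exists_finset_coe
  have hcard : ∀ k : ℕ, {x | x ∈ (s : Set α) ∧ f x = k}.ncard = (s.filter fun x => f x = k).card := by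
    intro k
    rw [← Set.ncard_coe_finset]
    congr 1
    ext x
    simp
  simp only [hcard]
  rw [finsum_mem_coe_finset, Finset.sum_comp g f]
  apply finsum_eq_sum_of_support_subset
  intro k hk
  simp only [Finset.coe_image, Set.mem_image, Finset.mem_coe]
  by_contra hne
  apply hk
  have : (s.filter fun x => f x = k) = ∅ := by
    ext x
    simp only [Finset.mem_filter, Finset.notMem_empty, iff_false, not_and]
    intro hx hfx
    exact hne ⟨x, hx, hfx⟩
  simp [this]

/-! ### Row-standard fillings of two rows -/

/-- The cells of two left-justified rows of lengths `a` and `b`. -/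
def cells (a b : ℕ) : Set (ℕ × ℕ) := {p | p.1 = 0 ∧ p.2 < a ∨ p.1 = 1 ∧ p.2 < b}

/-- `τ` fills the cells in `C` bijectively with `1, …, N`, increasingly along rows, and vanishes
outside `C`. -/
structure Fills (C : Set (ℕ × ℕ)) (N : ℕ) (τ : ℕ → ℕ → ℕ) : Prop where
  row_lt : ∀ r c₁ c₂ : ℕ, c₁ < c₂ → (r, c₂) ∈ C → τ r c₁ < τ r c₂
  standard : Set.BijOn (fun p : ℕ × ℕ => τ p.1 p.2) C (Set.Icc 1 N)
  zeros : ∀ r c : ℕ, (r, c) ∉ C → τ r c = 0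

/-- Write `n` into the cell `(r, c)`. -/
def setCell (r c n : ℕ) (τ : ℕ → ℕ → ℕ) : ℕ → ℕ → ℕ :=
  fun r' c' => if r' = r ∧ c' = c then n else τ r' c'

/-- Interchange the first two rows. -/
def swapRows (τ : ℕ → ℕ → ℕ) : ℕ → ℕ → ℕ := fun r => τ (Equiv.swap 0 1 r)

theorem setCell_self (r c n : ℕ) (τ : ℕ → ℕ → ℕ) : setCell r c n τ r c = n := by
  simp [setCell]

theorem setCell_of_ne {r c r' c' : ℕ} (n : ℕ) (τ : ℕ → ℕ → ℕ) (h : ¬ (r' = r ∧ c' = c)) :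
    setCell r c n τ r' c' = τ r' c' := by
  simp [setCell, h]

variable {C : Set (ℕ × ℕ)} {N r c : ℕ} {τ : ℕ → ℕ → ℕ}

theorem Fills.le (h : Fills C N τ) (r c : ℕ) : τ r c ≤ N := by
  by_cases hp : (r, c) ∈ C
  · exact (h.standard.mapsTo hp).2
  · simp [h.zeros r c hp]

theorem Fills.pos (h : Fills C N τ) (hp : (r, c) ∈ C) : 0 < τ r c :=
  (h.standard.mapsTo hp).1

theorem Fills.setCell_insert (h : Fills C N τ) (hp : (r, c) ∉ C)
    (hrow : ∀ c', (r, c') ∈ C → c' < c) :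
    Fills (insert (r, c) C) (N + 1) (setCell r c (N + 1) τ) := by
  have hold : ∀ p ∈ C, setCell r c (N + 1) τ p.1 p.2 = τ p.1 p.2 := by
    rintro ⟨r', c'⟩ hpC
    apply setCell_of_ne
    rintro ⟨rfl, rfl⟩
    exact hp hpC
  refine ⟨?_, ?_, ?_⟩
  · intro r' c₁ c₂ hlt hmem
    rcases hmem with heq | hmem
    · obtain ⟨rfl, rfl⟩ := Prod.mk.inj heq
      rw [setCell_self, setCell_of_ne _ _ (by omega)]
      exact Nat.lt_succ_of_le (h.le _ _)
    · rw [hold _ hmem, setCell_of_ne]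
      · exact h.row_lt _ _ _ hlt hmem
      · rintro ⟨rfl, rfl⟩
        exact absurd (hrow _ hmem) (by omega)
  · have hIcc : Set.Icc 1 (N + 1) = insert (N + 1) (Set.Icc 1 N) := by
      ext x; simp only [Set.mem_Icc, Set.mem_insert_iff]; omega
    have hb : Set.BijOn (fun p : ℕ × ℕ => setCell r c (N + 1) τ p.1 p.2) C (Set.Icc 1 N) :=
      h.standard.congr fun p hpC => (hold p hpC).symm
    have := hb.insert (a := (r, c)) (by simp [setCell_self])
    rw [hIcc]
    simpa [setCell_self] using this
  · intro r' c' hmem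
    rw [Set.mem_insert_iff, not_or] at hmem
    rw [setCell_of_ne _ _ (by rintro ⟨rfl, rfl⟩; exact hmem.1 rfl)]
    exact h.zeros _ _ hmem.2

theorem Fills.setCell_zero (h : Fills (insert (r, c) C) (N + 1) τ) (hp : (r, c) ∉ C)
    (hmax : τ r c = N + 1) : Fills C N (setCell r c 0 τ) := by
  have hold : ∀ p ∈ C, setCell r c 0 τ p.1 p.2 = τ p.1 p.2 := by
    rintro ⟨r', c'⟩ hpC
    apply setCell_of_ne
    rintro ⟨rfl, rfl⟩
    exact hp hpC
  refine ⟨?_, ?_, ?_⟩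
  · intro r' c₁ c₂ hlt hmem
    have hlt' := h.row_lt r' c₁ c₂ hlt (Or.inr hmem)
    rw [hold _ hmem, setCell_of_ne]
    · exact hlt'
    · rintro ⟨rfl, rfl⟩
      have := h.le r' c₂
      omega
  · have hIcc : Set.Icc 1 N = Set.Icc 1 (N + 1) \ {N + 1} := by
      ext x; simp only [Set.mem_Icc, Set.mem_sdiff, Set.mem_singleton_iff]; omega
    have hb := h.standard.sdiff_singleton (a := (r, c)) (Set.mem_insert _ _)
    rw [Set.insert_sdiff_self_of_notMem hp] at hb
    simp only [hmax] at hb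
    rw [hIcc]
    exact hb.congr fun p hpC => (hold p hpC).symm
  · intro r' c' hmem
    by_cases heq : r' = r ∧ c' = c
    · simp [setCell, heq]
    · rw [setCell_of_ne _ _ heq]
      apply h.zeros
      rw [Set.mem_insert_iff, not_or]
      exact ⟨fun he => heq (Prod.mk.inj he), hmem⟩

/-- Overwriting a cell outside `C` loses nothing, since every filling is `0` there. -/
theorem setCell_injOn (r c n : ℕ) (h : (r, c) ∉ C) :
    Set.InjOn (setCell r c n) {τ | Fills C N τ} := by
  intro τ hτ σ hσ heq
  funext r' c'
  by_cases hrc : r' = r ∧ c' = c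
  · rw [hrc.1, hrc.2, hτ.zeros _ _ h, hσ.zeros _ _ h]
  · simpa [setCell_of_ne _ _ hrc] using congrFun (congrFun heq r') c'

theorem insert_cells_top (a b : ℕ) : insert (0, a) (cells a b) = cells (a + 1) b := by
  ext ⟨r, c⟩
  simp only [cells, Set.mem_insert_iff, Set.mem_ofPred_eq, Prod.mk.injEq]
  omega

theorem insert_cells_bottom (a b : ℕ) : insert (1, b) (cells a b) = cells a (b + 1) := by
  ext ⟨r, c⟩
  simp only [cells, Set.mem_insert_iff, Set.mem_ofPred_eq, Prod.mk.injEq]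
  omega

/-- The row-standard fillings of two rows of lengths `a` and `b`. -/
def fillings (N a b : ℕ) : Set (ℕ → ℕ → ℕ) := {τ | Fills (cells a b) N τ}

theorem zero_mk_notMem_cells (a b : ℕ) : (0, a) ∉ cells a b := by simp [cells]

theorem one_mk_notMem_cells (a b : ℕ) : (1, b) ∉ cells a b := by simp [cells]

theorem setCell_top_mem {a b : ℕ} (h : τ ∈ fillings N a b) :
    setCell 0 a (N + 1) τ ∈ fillings (N + 1) (a + 1) b := by
  have := Fills.setCell_insert h (zero_mk_notMem_cells a b) (by simp [cells])
  rwa [insert_cells_top] at this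

theorem setCell_bottom_mem {a b : ℕ} (h : τ ∈ fillings N a b) :
    setCell 1 b (N + 1) τ ∈ fillings (N + 1) a (b + 1) := by
  have := Fills.setCell_insert h (one_mk_notMem_cells a b) (by simp [cells])
  rwa [insert_cells_bottom] at this

theorem setCell_setCell_zero {n : ℕ} (h : τ r c = n) :
    setCell r c n (setCell r c 0 τ) = τ := by
  funext r' c'
  by_cases hrc : r' = r ∧ c' = c
  · rw [hrc.1, hrc.2, setCell_self, h]
  · rw [setCell_of_ne _ _ hrc, setCell_of_ne _ _ hrc]

/-- The largest entry of a filling stands at the end of one of the rows. -/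
theorem max_at_end {a b : ℕ} (h : τ ∈ fillings (N + 1) a b) :
    (∃ a', a = a' + 1 ∧ τ 0 a' = N + 1) ∨ (∃ b', b = b' + 1 ∧ τ 1 b' = N + 1) := by
  obtain ⟨⟨r, c⟩, hmem, hval⟩ := h.standard.surjOn (show N + 1 ∈ Set.Icc 1 (N + 1) by simp)
  simp only at hval
  -- A right neighbour would have to exceed the maximum `N + 1`.
  have hlast : (r, c + 1) ∉ cells a b := fun hm => by
    have h1 := h.row_lt r c (c + 1) (Nat.lt_succ_self c) hm
    have h2 := Fills.le h r (c + 1)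
    omega
  simp only [cells, Set.mem_ofPred_eq] at hmem hlast
  rcases hmem with ⟨rfl, hc⟩ | ⟨rfl, hc⟩
  · exact Or.inl ⟨c, by omega, hval⟩
  · exact Or.inr ⟨c, by omega, hval⟩

theorem setCell_top_zero_mem {a b : ℕ} (h : τ ∈ fillings (N + 1) (a + 1) b)
    (hmax : τ 0 a = N + 1) : setCell 0 a 0 τ ∈ fillings N a b := by
  refine Fills.setCell_zero (C := cells a b) ?_ (zero_mk_notMem_cells a b) hmax
  rw [insert_cells_top]
  exact h

theorem setCell_bottom_zero_mem {a b : ℕ} (h : τ ∈ fillings (N + 1) a (b + 1))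
    (hmax : τ 1 b = N + 1) : setCell 1 b 0 τ ∈ fillings N a b := by
  refine Fills.setCell_zero (C := cells a b) ?_ (one_mk_notMem_cells a b) hmax
  rw [insert_cells_bottom]
  exact h

theorem fillings_succ_zero (N a : ℕ) :
    fillings (N + 1) (a + 1) 0 = setCell 0 a (N + 1) '' fillings N a 0 := by
  ext τ
  constructor
  · intro h
    rcases max_at_end h with ⟨a', ha, hm⟩ | ⟨b', hb, -⟩
    · obtain rfl : a = a' := by omega
      exact ⟨_, setCell_top_zero_mem h hm, setCell_setCell_zero hm⟩
    · omega
  · rintro ⟨σ, hσ, rfl⟩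
    exact setCell_top_mem hσ

/-- Split by the row that holds the maximum. No relation between `a` and `b` is imposed, because the
diagonal case passes through the shape `(m, m + 1)`. -/
theorem fillings_succ_succ (N a b : ℕ) :
    fillings (N + 1) (a + 1) (b + 1) =
      setCell 0 a (N + 1) '' fillings N a (b + 1) ∪
        setCell 1 b (N + 1) '' fillings N (a + 1) b := by
  ext τ
  constructor
  · intro h
    rcases max_at_end h with ⟨a', ha, hm⟩ | ⟨b', hb, hm⟩
    · obtain rfl : a = a' := by omega
      exact Or.inl ⟨_, setCell_top_zero_mem h hm, setCell_setCell_zero hm⟩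
    · obtain rfl : b = b' := by omega
      exact Or.inr ⟨_, setCell_bottom_zero_mem h hm, setCell_setCell_zero hm⟩
  · rintro (⟨σ, hσ, rfl⟩ | ⟨σ, hσ, rfl⟩)
    · exact setCell_top_mem hσ
    · exact setCell_bottom_mem hσ

theorem disjoint_top_bottom (N a b : ℕ) :
    Disjoint (setCell 0 a (N + 1) '' fillings N a (b + 1))
      (setCell 1 b (N + 1) '' fillings N (a + 1) b) := by
  rw [Set.disjoint_left]
  rintro _ ⟨σ, -, rfl⟩ ⟨ρ, hρ, heq⟩
  have h1 := congrFun (congrFun heq 0) a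
  rw [setCell_self, setCell_of_ne _ _ (by omega)] at h1
  have := Fills.le hρ 0 a
  omega

theorem swapRows_swapRows (τ : ℕ → ℕ → ℕ) : swapRows (swapRows τ) = τ := by
  funext r
  simp [swapRows]

theorem swapRows_mem {a b : ℕ} (h : τ ∈ fillings N a b) : swapRows τ ∈ fillings N b a := by
  have key : ∀ r c, (Equiv.swap 0 1 r, c) ∈ cells a b ↔ (r, c) ∈ cells b a := by
    intro r c
    simp only [cells, Set.mem_ofPred_eq, Equiv.swap_apply_def]
    grind
  refine ⟨?_, ?_, ?_⟩
  · intro r c₁ c₂ hlt hmem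
    exact h.row_lt _ _ _ hlt ((key _ _).2 hmem)
  · have hb : Set.BijOn (Prod.map (Equiv.swap (0 : ℕ) 1) id) (cells b a) (cells a b) := by
      refine ⟨fun p hp => (key _ _).2 hp, ?_, ?_⟩
      · exact (Function.Injective.prodMap (Equiv.injective _) Function.injective_id).injOn
      · rintro ⟨r, c⟩ hp
        refine ⟨(Equiv.swap 0 1 r, c), (key _ _).1 (by simpa using hp), by simp⟩
    exact h.standard.comp hb
  · intro r c hmem
    exact h.zeros _ _ fun hm => hmem ((key _ _).1 hm)

theorem swapRows_setCell_bottom (b n : ℕ) (τ : ℕ → ℕ → ℕ) :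
    swapRows (setCell 1 b n τ) = setCell 0 b n (swapRows τ) := by
  funext r c
  have : Equiv.swap 0 1 r = 1 ↔ r = 0 := by
    rw [Equiv.swap_apply_def]; grind
  simp [swapRows, setCell, this]

theorem fillings_top_eq_swapRows_image (N m : ℕ) :
    setCell 0 m (N + 1) '' fillings N m (m + 1) =
      (fun τ => swapRows (setCell 1 m (N + 1) τ)) '' fillings N (m + 1) m := by
  ext τ
  constructor
  · rintro ⟨σ, hσ, rfl⟩
    refine ⟨swapRows σ, swapRows_mem hσ, ?_⟩
    simp only [swapRows_setCell_bottom, swapRows_swapRows]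
  · rintro ⟨σ, hσ, rfl⟩
    exact ⟨swapRows σ, swapRows_mem hσ, (swapRows_setCell_bottom _ _ _).symm⟩

theorem fillings_finite (N a b : ℕ) : (fillings N a b).Finite := by
  induction N generalizing a b with
  | zero =>
    refine (Set.finite_singleton fun _ _ => 0).subset ?_
    intro τ h
    funext r c
    exact Nat.le_zero.1 (Fills.le h r c)
  | succ N ih =>
    -- Truncated subtraction is harmless: `max_at_end` makes the shortened row nonempty.
    refine (((ih (a - 1) b).image (setCell 0 (a - 1) (N + 1))).union
      ((ih a (b - 1)).image (setCell 1 (b - 1) (N + 1)))).subset ?_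
    intro τ h
    rcases max_at_end h with ⟨a', rfl, hm⟩ | ⟨b', rfl, hm⟩
    · exact Or.inl ⟨_, setCell_top_zero_mem h hm, setCell_setCell_zero hm⟩
    · exact Or.inr ⟨_, setCell_bottom_zero_mem h hm, setCell_setCell_zero hm⟩

/-! ### Inversions as sign changes -/

/-- The entry of the second row in column `c` exists and is the smaller one of its column. -/
def Descends (τ : ℕ → ℕ → ℕ) (c : ℕ) : Prop := τ 1 c ≠ 0 ∧ τ 1 c < τ 0 c

open Classical in
/-- The number of changes of relative order between neighbouring columns among `0, …, b`. -/
noncomputable def signChanges (b : ℕ) (τ : ℕ → ℕ → ℕ) : ℕ :=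
  ((Finset.range b).filter fun c => ¬ (Descends τ c ↔ Descends τ (c + 1))).card

theorem signChanges_congr {b : ℕ} {σ : ℕ → ℕ → ℕ}
    (h : ∀ c ≤ b, Descends τ c ↔ Descends σ c) : signChanges b τ = signChanges b σ := by
  classical
  unfold signChanges
  congr 1
  apply Finset.filter_congr
  intro c hc
  rw [Finset.mem_range] at hc
  rw [h c hc.le, h (c + 1) hc]

theorem signChanges_succ (b : ℕ) (τ : ℕ → ℕ → ℕ) [Decidable (Descends τ b ↔ Descends τ (b + 1))] :
    signChanges (b + 1) τ =
      signChanges b τ + if (Descends τ b ↔ Descends τ (b + 1)) then 0 else 1 := by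
  unfold signChanges
  rw [Finset.range_add_one, Finset.filter_insert]
  split_ifs with h1
  · rfl
  · rw [Finset.card_insert_of_notMem (by simp)]

theorem Fills.eq_zero_bottom {a b : ℕ} (h : τ ∈ fillings N a b) {c : ℕ} (hc : b ≤ c) :
    τ 1 c = 0 := h.zeros _ _ (by simp [cells, hc])

theorem not_descends_of_le {a b : ℕ} (h : τ ∈ fillings N a b) {c : ℕ} (hc : b ≤ c) :
    ¬ Descends τ c := fun hd => hd.1 (Fills.eq_zero_bottom h hc)

/-- As `b ≤ a`, the new entry lies in a column without a lower entry, which is not descending before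
or after. -/
theorem signChanges_setCell_top {a b : ℕ} (hab : b ≤ a) (h : τ ∈ fillings N a b) :
    signChanges b (setCell 0 a (N + 1) τ) = signChanges b τ := by
  apply signChanges_congr
  intro c hc
  rcases hc.lt_or_eq with hlt | rfl
  · unfold Descends
    rw [setCell_of_ne _ _ (by omega), setCell_of_ne _ _ (by omega)]
  · exact iff_of_false (not_descends_of_le (setCell_top_mem h) le_rfl)
      (not_descends_of_le h le_rfl)

/-- The new lower entry is the maximum, so its column stays not descending. -/
theorem descends_setCell_bottom {a b : ℕ} (h : τ ∈ fillings N a b) (c : ℕ) :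
    Descends (setCell 1 b (N + 1) τ) c ↔ Descends τ c := by
  by_cases hc : c = b
  · subst hc
    refine iff_of_false (fun hd => ?_) (not_descends_of_le h le_rfl)
    have h1 := hd.2
    rw [setCell_self, setCell_of_ne _ _ (by omega)] at h1
    have := Fills.le h 0 c
    omega
  · unfold Descends
    rw [setCell_of_ne _ _ (by omega), setCell_of_ne _ _ (by omega)]

theorem signChanges_setCell_bottom {a b : ℕ} (h : τ ∈ fillings N a b) :
    signChanges (b + 1) (setCell 1 b (N + 1) τ) = signChanges b τ := by
  classical
  rw [signChanges_congr fun c _ => descends_setCell_bottom h c, signChanges_succ,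
    if_pos (iff_of_false (not_descends_of_le h le_rfl) (not_descends_of_le h (Nat.le_succ b)))]
  rfl

theorem Fills.ne_of_mem {a b : ℕ} (h : τ ∈ fillings N a b) {c : ℕ} (ha : c < a) (hb : c < b) :
    τ 0 c ≠ τ 1 c := fun heq => by
  have := h.standard.injOn (show (0, c) ∈ cells a b from Or.inl ⟨rfl, ha⟩)
    (show (1, c) ∈ cells a b from Or.inr ⟨rfl, hb⟩) heq
  simp at this

theorem descends_iff {a b : ℕ} (h : τ ∈ fillings N a b) {c : ℕ} (hb : c < b) :
    Descends τ c ↔ τ 1 c < τ 0 c :=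
  and_iff_right (Fills.pos h (Or.inr ⟨rfl, hb⟩)).ne'

theorem descends_swapRows {m : ℕ} (h : τ ∈ fillings N m m) {c : ℕ} (hc : c < m) :
    Descends (swapRows τ) c ↔ ¬ Descends τ c := by
  rw [descends_iff h hc, descends_iff (swapRows_mem h) hc]
  have := Fills.ne_of_mem h hc hc
  simp only [swapRows, Equiv.swap_apply_left, Equiv.swap_apply_right]
  omega

/-- The swap flips every full column, so comparisons among these are preserved. The empty column `m
+ 1` is not flipped, so the comparison with column `m` turns from agreement into a change. -/
theorem signChanges_swapRows {m : ℕ} (h : τ ∈ fillings N (m + 1) (m + 1))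
    (hm : ¬ Descends τ m) :
    signChanges (m + 1) (swapRows τ) = signChanges (m + 1) τ + 1 := by
  classical
  have h1 := not_descends_of_le h le_rfl
  have h2 := not_descends_of_le (swapRows_mem h) le_rfl
  have h3 := (descends_swapRows h (Nat.lt_succ_self m)).2 hm
  rw [signChanges_succ, signChanges_succ, if_pos (iff_of_false hm h1), if_neg (by tauto)]
  have : signChanges m (swapRows τ) = signChanges m τ := by
    unfold signChanges
    congr 1
    apply Finset.filter_congr
    intro c hc
    rw [Finset.mem_range] at hc
    rw [descends_swapRows h (by omega : c < m + 1), descends_swapRows h (by omega : c + 1 < m + 1)]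
    tauto
  rw [this]

/-! ### Dyck paths -/

/-- Paths with `N` steps from the origin to `(a, b)` that stay weakly below the diagonal. -/
def pathsTo (N a b : ℕ) : Set (Fin (N + 1) → ℕ × ℕ) :=
  {v | v 0 = (0, 0) ∧ v (Fin.last N) = (a, b) ∧
    (∀ i : Fin N, v i.succ = v i.castSucc + (1, 0) ∨ v i.succ = v i.castSucc + (0, 1)) ∧
    ∀ i : Fin (N + 1), (v i).2 ≤ (v i).1}

/-- Extend a path by one point. -/
def extend {n : ℕ} (p : ℕ × ℕ) (v : Fin n → ℕ × ℕ) : Fin (n + 1) → ℕ × ℕ :=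
  Fin.snoc (α := fun _ => ℕ × ℕ) v p

@[simp] theorem extend_last {n : ℕ} (p : ℕ × ℕ) (v : Fin n → ℕ × ℕ) :
    extend p v (Fin.last n) = p := by simp [extend]

@[simp] theorem extend_castSucc {n : ℕ} (p : ℕ × ℕ) (v : Fin n → ℕ × ℕ) (i : Fin n) :
    extend p v i.castSucc = v i := by simp [extend]

theorem extend_injective {n : ℕ} (p : ℕ × ℕ) :
    Function.Injective (extend p : (Fin n → ℕ × ℕ) → _) := by
  intro v w h
  funext i
  simpa using congrFun h i.castSucc

theorem extend_mem {M x y a b : ℕ} {v : Fin (M + 1) → ℕ × ℕ} (h : v ∈ pathsTo M x y)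
    (hab : b ≤ a) (hstep : (a, b) = (x, y) + (1, 0) ∨ (a, b) = (x, y) + (0, 1)) :
    extend (a, b) v ∈ pathsTo (M + 1) a b := by
  obtain ⟨h0, hl, hs, hd⟩ := h
  refine ⟨?_, extend_last _ _, ?_, ?_⟩
  · rw [← Fin.castSucc_zero, extend_castSucc, h0]
  · intro i
    refine Fin.lastCases ?_ (fun j => ?_) i
    · rw [Fin.succ_last, extend_last, extend_castSucc, hl]
      exact hstep
    · rw [Fin.succ_castSucc, extend_castSucc, extend_castSucc]
      exact hs j
  · intro i
    refine Fin.lastCases ?_ (fun j => ?_) i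
    · simpa using hab
    · simpa using hd j

theorem exists_extend {M a b : ℕ} {v : Fin (M + 2) → ℕ × ℕ} (h : v ∈ pathsTo (M + 1) a b) :
    ∃ x y, ∃ w ∈ pathsTo M x y, y ≤ x ∧ extend (a, b) w = v ∧
      ((a, b) = (x, y) + (1, 0) ∨ (a, b) = (x, y) + (0, 1)) := by
  obtain ⟨h0, hl, hs, hd⟩ := h
  refine ⟨(v (Fin.last M).castSucc).1, (v (Fin.last M).castSucc).2, fun i => v i.castSucc,
    ⟨?_, rfl, fun i => ?_, fun i => hd _⟩, hd _, ?_, ?_⟩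
  · exact h0
  · have := hs i.castSucc
    rwa [Fin.succ_castSucc] at this
  · funext i
    refine Fin.lastCases ?_ (fun j => ?_) i
    · rw [extend_last, hl]
    · rw [extend_castSucc]
  · have := hs (Fin.last M)
    rwa [Fin.succ_last, hl] at this

theorem pathsTo_succ_zero (M a : ℕ) :
    pathsTo (M + 1) (a + 1) 0 = extend (a + 1, 0) '' pathsTo M a 0 := by
  ext v
  constructor
  · intro h
    obtain ⟨x, y, w, hw, -, rfl, hstep⟩ := exists_extend h
    simp only [Prod.mk_add_mk, Prod.mk.injEq] at hstep
    obtain ⟨rfl, rfl⟩ : x = a ∧ y = 0 := by omega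
    exact ⟨w, hw, rfl⟩
  · rintro ⟨w, hw, rfl⟩
    exact extend_mem hw (Nat.zero_le _) (Or.inl rfl)

theorem pathsTo_succ_succ (M : ℕ) {a b : ℕ} (hab : b + 1 ≤ a) :
    pathsTo (M + 1) (a + 1) (b + 1) =
      extend (a + 1, b + 1) '' pathsTo M a (b + 1) ∪
        extend (a + 1, b + 1) '' pathsTo M (a + 1) b := by
  ext v
  constructor
  · intro h
    obtain ⟨x, y, w, hw, -, rfl, hstep⟩ := exists_extend h
    simp only [Prod.mk_add_mk, Prod.mk.injEq] at hstep
    rcases hstep with hstep | hstep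
    · obtain ⟨rfl, rfl⟩ : x = a ∧ y = b + 1 := by omega
      exact Or.inl ⟨w, hw, rfl⟩
    · obtain ⟨rfl, rfl⟩ : x = a + 1 ∧ y = b := by omega
      exact Or.inr ⟨w, hw, rfl⟩
  · rintro (⟨w, hw, rfl⟩ | ⟨w, hw, rfl⟩)
    · exact extend_mem hw (by omega) (Or.inl rfl)
    · exact extend_mem hw (by omega) (Or.inr rfl)

/-- The other candidate predecessor, `(m, m + 1)`, lies above the diagonal. -/
theorem pathsTo_diagonal (M m : ℕ) :
    pathsTo (M + 1) (m + 1) (m + 1) = extend (m + 1, m + 1) '' pathsTo M (m + 1) m := by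
  ext v
  constructor
  · intro h
    obtain ⟨x, y, w, hw, hxy, rfl, hstep⟩ := exists_extend h
    simp only [Prod.mk_add_mk, Prod.mk.injEq] at hstep
    obtain ⟨rfl, rfl⟩ : x = m + 1 ∧ y = m := by omega
    exact ⟨w, hw, rfl⟩
  · rintro ⟨w, hw, rfl⟩
    exact extend_mem hw le_rfl (Or.inr rfl)

theorem disjoint_extend (M a b : ℕ) (p : ℕ × ℕ) :
    Disjoint (extend p '' pathsTo M a (b + 1)) (extend p '' pathsTo M (a + 1) b) := by
  rw [Set.disjoint_left]
  rintro _ ⟨v, hv, rfl⟩ ⟨w, hw, heq⟩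
  have h1 := hv.2.1
  rw [← extend_injective p heq, hw.2.1] at h1
  simp at h1

theorem pathsTo_finite (M a b : ℕ) : (pathsTo M a b).Finite := by
  induction M generalizing a b with
  | zero =>
    refine (Set.finite_singleton fun _ => (0, 0)).subset ?_
    intro v h
    funext i
    obtain rfl : i = 0 := Fin.ext (by omega)
    exact h.1
  | succ M ih =>
    refine (((ih (a - 1) b).image (extend (a, b))).union
      ((ih a (b - 1)).image (extend (a, b)))).subset ?_
    intro v h
    obtain ⟨x, y, w, hw, -, rfl, hstep⟩ := exists_extend h
    simp only [Prod.mk_add_mk, Prod.mk.injEq] at hstep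
    rcases hstep with ⟨rfl, rfl⟩ | ⟨rfl, rfl⟩
    · exact Or.inl ⟨w, hw, rfl⟩
    · exact Or.inr ⟨w, hw, rfl⟩

theorem ret_extend_of_ne {n a b : ℕ} (h : a ≠ b) (v : Fin n → ℕ × ℕ) :
    ret (extend (a, b) v) = ret v := by
  classical
  unfold ret
  rw [Finset.card_filter, Finset.card_filter, Fin.sum_univ_castSucc, extend_last, if_neg, add_zero]
  · exact Finset.sum_congr rfl fun i _ => if_congr (by rw [extend_castSucc]) rfl rfl
  · rintro ⟨x, -, hx⟩
    obtain ⟨rfl, rfl⟩ := Prod.mk.inj hx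
    exact h rfl

theorem ret_extend_diagonal {n : ℕ} (m : ℕ) (v : Fin n → ℕ × ℕ) :
    ret (extend (m + 1, m + 1) v) = ret v + 1 := by
  classical
  unfold ret
  rw [Finset.card_filter, Finset.card_filter, Fin.sum_univ_castSucc, extend_last, if_pos]
  · exact congrArg (· + 1)
      (Finset.sum_congr rfl fun i _ => if_congr (by rw [extend_castSucc]) rfl rfl)
  · exact ⟨m + 1, Nat.succ_pos m, rfl⟩

/-! ### The common recursion -/

section Recursion

variable {R : Type*} [CommSemiring R] (q : R)

/-- The enumerator of row-standard fillings by sign changes. -/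
noncomputable def fillingSum (N a b : ℕ) : R := ∑ᶠ τ ∈ fillings N a b, q ^ signChanges b τ

/-- The enumerator of Dyck paths by returns to ground. -/
noncomputable def pathSum (N a b : ℕ) : R := ∑ᶠ v ∈ pathsTo N a b, q ^ ret v

theorem setCell_top_injOn (N a b n : ℕ) : Set.InjOn (setCell 0 a n) (fillings N a b) :=
  setCell_injOn 0 a n (zero_mk_notMem_cells a b)

theorem setCell_bottom_injOn (N a b n : ℕ) : Set.InjOn (setCell 1 b n) (fillings N a b) :=
  setCell_injOn 1 b n (one_mk_notMem_cells a b)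

theorem finsum_setCell_top {N a b : ℕ} (hab : b ≤ a) :
    ∑ᶠ τ ∈ setCell 0 a (N + 1) '' fillings N a b, q ^ signChanges b τ = fillingSum q N a b := by
  rw [finsum_mem_image (setCell_top_injOn N a b _)]
  exact finsum_mem_congr rfl fun τ hτ => by rw [signChanges_setCell_top hab hτ]

theorem finsum_setCell_bottom (N a b : ℕ) :
    ∑ᶠ τ ∈ setCell 1 b (N + 1) '' fillings N a b, q ^ signChanges (b + 1) τ =
      fillingSum q N a b := by
  rw [finsum_mem_image (setCell_bottom_injOn N a b _)]
  exact finsum_mem_congr rfl fun τ hτ => by rw [signChanges_setCell_bottom hτ]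

theorem fillingSum_succ_zero (N a : ℕ) :
    fillingSum q (N + 1) (a + 1) 0 = fillingSum q N a 0 := by
  rw [← finsum_setCell_top q (Nat.zero_le a), ← fillings_succ_zero, fillingSum]

theorem fillingSum_succ_succ (N : ℕ) {a b : ℕ} (hab : b + 1 ≤ a) :
    fillingSum q (N + 1) (a + 1) (b + 1) =
      fillingSum q N a (b + 1) + fillingSum q N (a + 1) b := by
  rw [← finsum_setCell_top q hab, ← finsum_setCell_bottom q N, fillingSum, fillings_succ_succ,
    finsum_mem_union (disjoint_top_bottom N a b) ((fillings_finite _ _ _).image _)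
      ((fillings_finite _ _ _).image _)]

/-- Maximum below contributes `1`. Maximum above is the row swap of that case and contributes `q`.
-/
theorem fillingSum_diagonal (N m : ℕ) :
    fillingSum q (N + 1) (m + 1) (m + 1) = (1 + q) * fillingSum q N (m + 1) m := by
  rw [fillingSum, fillings_succ_succ,
    finsum_mem_union (disjoint_top_bottom N m m) ((fillings_finite _ _ _).image _)
      ((fillings_finite _ _ _).image _), finsum_setCell_bottom, fillings_top_eq_swapRows_image,
    finsum_mem_image, add_comm, add_mul, one_mul]
  · congr 1
    rw [fillingSum, mul_finsum_mem' _ _ (fillings_finite _ _ _)]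
    refine finsum_mem_congr rfl fun τ hτ => ?_
    rw [signChanges_swapRows (setCell_bottom_mem hτ), signChanges_setCell_bottom hτ, pow_succ']
    rw [descends_setCell_bottom hτ]
    exact not_descends_of_le hτ le_rfl
  · intro τ hτ σ hσ heq
    have := congrArg swapRows heq
    simp only [swapRows_swapRows] at this
    exact setCell_bottom_injOn _ _ _ _ hτ hσ this

theorem pathSum_succ_zero (N a : ℕ) : pathSum q (N + 1) (a + 1) 0 = pathSum q N a 0 := by
  rw [pathSum, pathsTo_succ_zero, finsum_mem_image (extend_injective _).injOn]
  exact finsum_mem_congr rfl fun v _ => by rw [ret_extend_of_ne (Nat.succ_ne_zero a)]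

theorem pathSum_succ_succ (N : ℕ) {a b : ℕ} (hab : b + 1 ≤ a) :
    pathSum q (N + 1) (a + 1) (b + 1) = pathSum q N a (b + 1) + pathSum q N (a + 1) b := by
  rw [pathSum, pathsTo_succ_succ N hab, finsum_mem_union (disjoint_extend N a b _)
      ((pathsTo_finite _ _ _).image _) ((pathsTo_finite _ _ _).image _),
    finsum_mem_image (extend_injective _).injOn, finsum_mem_image (extend_injective _).injOn]
  congr 1 <;>
  exact finsum_mem_congr rfl fun v _ => by rw [ret_extend_of_ne (by omega)]

theorem pathSum_diagonal (N m : ℕ) :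
    pathSum q (N + 1) (m + 1) (m + 1) = q * pathSum q N (m + 1) m := by
  rw [pathSum, pathsTo_diagonal, finsum_mem_image (extend_injective _).injOn, pathSum,
    mul_finsum_mem' _ _ (pathsTo_finite _ _ _)]
  exact finsum_mem_congr rfl fun v _ => by rw [ret_extend_diagonal, pow_succ']

theorem fillings_zero : fillings 0 0 0 = {fun _ _ => 0} := by
  refine Set.eq_singleton_iff_unique_mem.2 ⟨⟨?_, ?_, fun _ _ _ => rfl⟩, fun τ h => ?_⟩
  · simp [cells]
  · have h1 : cells 0 0 = ∅ := by ext; simp [cells]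
    have h2 : Set.Icc 1 0 = (∅ : Set ℕ) := by simp
    rw [h1, h2]
    exact Set.bijOn_empty _
  · funext r c
    exact Nat.le_zero.1 (Fills.le h r c)

theorem pathsTo_zero : pathsTo 0 0 0 = {fun _ => (0, 0)} := by
  refine Set.eq_singleton_iff_unique_mem.2
    ⟨⟨rfl, rfl, fun i => i.elim0, fun _ => le_rfl⟩, fun v h => ?_⟩
  funext i
  obtain rfl : i = 0 := Fin.ext (by omega)
  exact h.1

theorem fillingSum_eq_pathSum {N a b : ℕ} (hab : b ≤ a) (hN : a + b = N) :
    fillingSum q N a b = pathSum (1 + q) N a b := by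
  induction N generalizing a b with
  | zero =>
    obtain ⟨rfl, rfl⟩ : a = 0 ∧ b = 0 := by omega
    rw [fillingSum, pathSum, fillings_zero, pathsTo_zero, finsum_mem_singleton,
      finsum_mem_singleton]
    simp [signChanges, ret]
  | succ N ih =>
    obtain ⟨a, rfl⟩ : ∃ a', a = a' + 1 := ⟨a - 1, by omega⟩
    rcases b with _ | b
    · rw [fillingSum_succ_zero, pathSum_succ_zero, ih (Nat.zero_le a) (by omega)]
    · rcases (Nat.le_of_succ_le_succ hab).lt_or_eq with hlt | rfl
      · rw [fillingSum_succ_succ q N hlt, pathSum_succ_succ _ N hlt, ih hlt (by omega),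
          ih (by omega) (by omega)]
      · rw [fillingSum_diagonal, pathSum_diagonal, ih (by omega) (by omega)]

end Recursion

/-! ### Two-row Young diagrams -/

theorem mem_twoRow {a b : ℕ} (hab : b ≤ a) {p : ℕ × ℕ} : p ∈ twoRow a b hab ↔ p ∈ cells a b := by
  obtain ⟨r, c⟩ := p
  rw [twoRow, YoungDiagram.mem_ofRowLens]
  rcases r with _ | _ | r <;> simp [cells]

theorem card_twoRow {a b : ℕ} (hab : b ≤ a) : (twoRow a b hab).card = a + b := by
  have : (twoRow a b hab).cells =
      ({0} ×ˢ Finset.range a) ∪ ({1} ×ˢ Finset.range b) := by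
    ext p
    rw [YoungDiagram.mem_cells, mem_twoRow, Finset.mem_union, Finset.mem_product,
      Finset.mem_product]
    simp only [cells, Set.mem_ofPred_eq, Finset.mem_singleton, Finset.mem_range]
  rw [YoungDiagram.card, this, Finset.card_union_of_disjoint]
  · simp
  · rw [Finset.disjoint_left]
    rintro ⟨r, c⟩ h1 h2
    simp only [Finset.mem_product, Finset.mem_singleton] at h1 h2
    omega

theorem invertedSYT_twoRow {a b : ℕ} (hab : b ≤ a) :
    invertedSYT (twoRow a b hab) = fillings (a + b) a b := by
  have hset : {p | p ∈ twoRow a b hab} = cells a b := Set.ext fun p => mem_twoRow hab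
  ext τ
  constructor
  · rintro ⟨h1, h2, h3⟩
    rw [hset, card_twoRow] at h2
    simp only [mem_twoRow] at h1 h3
    exact ⟨h1, h2, h3⟩
  · rintro ⟨h1, h2, h3⟩
    refine ⟨?_, ?_, ?_⟩
    · simpa only [mem_twoRow] using h1
    · rwa [hset, card_twoRow]
    · simpa only [mem_twoRow] using h3

/-- The inversion pairs of a two-row filling, in terms of neighbouring columns. -/
theorem isInversionPair_iff {N a b : ℕ} (hab : b ≤ a) {τ : ℕ → ℕ → ℕ} (h : τ ∈ fillings N a b)
    (p q : ℕ × ℕ) :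
    IsInversionPair (twoRow a b hab) τ p q ↔ ∃ c < b,
      (p = (0, c) ∧ q = (1, c) ∧ ¬ Descends τ c ∧ Descends τ (c + 1)) ∨
      (p = (1, c) ∧ q = (0, c) ∧ Descends τ c ∧ ¬ Descends τ (c + 1)) := by
  obtain ⟨r, c⟩ := p
  obtain ⟨s, d⟩ := q
  have hn : ∀ {c}, c < b → τ 0 c ≠ τ 1 c := fun hc => Fills.ne_of_mem h (by omega) hc
  have hD : ∀ {c}, c < b → (Descends τ c ↔ τ 1 c < τ 0 c) := fun hc => descends_iff h hc
  have hb : ¬ Descends τ b := not_descends_of_le h le_rfl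
  constructor
  · rintro ⟨hp, hq, hcd, hlt, n, hagree, hcond⟩
    simp only at hcd hlt
    subst hcd
    rw [mem_twoRow] at hp hq
    -- Agreement one box to the right would put equal entries in different rows, against
    -- injectivity.
    obtain rfl : n = 0 := by
      by_contra hne
      obtain ⟨h1, h2, h3⟩ := hagree 1 le_rfl (by omega)
      have := h.standard.injOn ((mem_twoRow hab).1 h1) ((mem_twoRow hab).1 h2) h3
      obtain ⟨rfl, -⟩ := Prod.mk.inj this
      exact lt_irrefl _ hlt
    simp only [mem_twoRow, zero_add] at hcond
    simp only [cells, Set.mem_ofPred_eq] at hp hq hcond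
    have hrs : r ≠ s := by rintro rfl; exact lt_irrefl _ hlt
    rcases hp with ⟨rfl, hca⟩ | ⟨rfl, hcb⟩ <;> rcases hq with ⟨rfl, hca'⟩ | ⟨rfl, hcb'⟩
    · exact absurd rfl hrs
    · refine ⟨c, hcb', Or.inl ⟨rfl, rfl, ?_, ?_⟩⟩
      · rw [hD hcb']; omega
      · rw [hD (by omega)]; omega
    · refine ⟨c, hcb, Or.inr ⟨rfl, rfl, (hD hcb).2 hlt, ?_⟩⟩
      by_cases hc : c + 1 = b
      · rwa [hc]
      · rw [hD (by omega)]; omega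
    · exact absurd rfl hrs
  · rintro ⟨e, he, ⟨hp, hq, h1, h2⟩ | ⟨hp, hq, h1, h2⟩⟩
    all_goals
      obtain ⟨rfl, rfl⟩ := Prod.mk.inj hp
      obtain ⟨rfl, rfl⟩ := Prod.mk.inj hq
      have hne := hn he
      rw [hD he] at h1
      refine ⟨?_, ?_, rfl, ?_, 0, fun k h1 h2 => absurd h1 (by omega), ?_⟩
    · rw [mem_twoRow]; exact Or.inl ⟨rfl, by omega⟩
    · rw [mem_twoRow]; exact Or.inr ⟨rfl, he⟩
    · simp only; omega
    -- A descending column has a lower entry, so both right neighbours exist.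
    · have hlt : d + 1 < b := by
        by_contra hge
        exact not_descends_of_le h (by omega) h2
      rw [hD hlt] at h2
      exact Or.inr ⟨(mem_twoRow hab).2 (Or.inl ⟨rfl, by simp only; omega⟩),
        (mem_twoRow hab).2 (Or.inr ⟨rfl, hlt⟩), h2⟩
    · rw [mem_twoRow]; exact Or.inr ⟨rfl, he⟩
    · rw [mem_twoRow]; exact Or.inl ⟨rfl, by omega⟩
    · exact h1
    · by_cases hlt : d + 1 < b
      · rw [hD hlt] at h2
        have := hn hlt
        exact Or.inr ⟨(mem_twoRow hab).2 (Or.inr ⟨rfl, hlt⟩),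
          (mem_twoRow hab).2 (Or.inl ⟨rfl, by simp only; omega⟩), by simp only [zero_add]; omega⟩
      -- The lower row ends here, so the missing-neighbour clause applies, the smaller entry being
      -- below.
      · refine Or.inl ⟨Or.inl fun hm => ?_, Nat.zero_lt_one⟩
        rw [mem_twoRow] at hm
        simp [cells, hlt] at hm

/-- An inversion pair is determined by its column: whether that column descends fixes which cell
comes first. -/
theorem inv_twoRow {N a b : ℕ} (hab : b ≤ a) {τ : ℕ → ℕ → ℕ} (h : τ ∈ fillings N a b) :
    inv (twoRow a b hab) τ = signChanges b τ := by
  classical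
  unfold inv signChanges
  refine Finset.card_bij (fun x _ => x.1.2) ?_ ?_ ?_
  · rintro ⟨p, q⟩ hx
    rw [Finset.mem_filter] at hx
    obtain ⟨c, hc, hpq⟩ := (isInversionPair_iff hab h p q).1 hx.2
    rw [Finset.mem_filter, Finset.mem_range]
    rcases hpq with ⟨rfl, rfl, h1, h2⟩ | ⟨rfl, rfl, h1, h2⟩
    · exact ⟨hc, fun hiff => h1 (hiff.2 h2)⟩
    · exact ⟨hc, fun hiff => h2 (hiff.1 h1)⟩
  · rintro ⟨p, q⟩ hx ⟨p', q'⟩ hx' heq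
    rw [Finset.mem_filter] at hx hx'
    obtain ⟨c, hc, hpq⟩ := (isInversionPair_iff hab h p q).1 hx.2
    obtain ⟨c', hc', hpq'⟩ := (isInversionPair_iff hab h p' q').1 hx'.2
    rcases hpq with ⟨rfl, rfl, h1, h2⟩ | ⟨rfl, rfl, h1, h2⟩ <;>
      rcases hpq' with ⟨rfl, rfl, h1', h2'⟩ | ⟨rfl, rfl, h1', h2'⟩ <;>
      simp only at heq <;> subst heq
    · rfl
    · exact absurd h1' h1
    · exact absurd h1 h1'
    · rfl
  · intro c hc
    rw [Finset.mem_filter, Finset.mem_range] at hc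
    obtain ⟨hcb, hiff⟩ := hc
    have mem : ∀ {p q}, IsInversionPair (twoRow a b hab) τ p q →
        (p, q) ∈ ((twoRow a b hab).cells ×ˢ (twoRow a b hab).cells).filter
          fun x => IsInversionPair (twoRow a b hab) τ x.1 x.2 := fun hpq =>
      Finset.mem_filter.2 ⟨Finset.mem_product.2 ⟨hpq.1, hpq.2.1⟩, hpq⟩
    by_cases hd : Descends τ c
    · exact ⟨((1, c), (0, c)), mem ((isInversionPair_iff hab h _ _).2
        ⟨c, hcb, Or.inr ⟨rfl, rfl, hd, by tauto⟩⟩), rfl⟩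
    · exact ⟨((0, c), (1, c)), mem ((isInversionPair_iff hab h _ _).2
        ⟨c, hcb, Or.inl ⟨rfl, rfl, hd, by tauto⟩⟩), rfl⟩

end InvertedTableaux

theorem mainTheorem6 (a b : ℕ) (hb : 0 < b) (hab : b ≤ a) :
    (InvertedTableaux.invertedSYT (InvertedTableaux.twoRow a b hab)).Finite ∧
    (InvertedTableaux.dyckPaths a b).Finite ∧
    (∑ᶠ k : ℕ,
        (InvertedTableaux.kInvertedSYT (InvertedTableaux.twoRow a b hab) k).ncard •
          (Polynomial.X : ℕ[X]) ^ k) =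
      ∑ᶠ i : ℕ,
        (InvertedTableaux.dyckPathsWithReturns a b i).ncard • (1 + Polynomial.X : ℕ[X]) ^ i := by
  have hfin : (InvertedTableaux.invertedSYT (InvertedTableaux.twoRow a b hab)).Finite := by
    rw [InvertedTableaux.invertedSYT_twoRow]
    exact InvertedTableaux.fillings_finite _ _ _
  have hpaths : (InvertedTableaux.dyckPaths a b).Finite :=
    -- `dyckPaths a b` is definitionally `pathsTo (a + b) a b`.
    InvertedTableaux.pathsTo_finite (a + b) a b
  refine ⟨hfin, hpaths, ?_⟩
  refine (InvertedTableaux.finsum_ncard_fiber_smul hfin _ _).trans <| Eq.trans ?_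
    (InvertedTableaux.finsum_ncard_fiber_smul hpaths _ _).symm
  rw [InvertedTableaux.invertedSYT_twoRow]
  refine Eq.trans ?_ (InvertedTableaux.fillingSum_eq_pathSum (Polynomial.X : ℕ[X]) hab rfl)
  exact finsum_mem_congr rfl fun τ hτ => by rw [InvertedTableaux.inv_twoRow hab hτ]
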